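/- Let $p$ be a prime number, and let $G$ be a primitive permutation group on a finite set $\Omega$ with $|\Omega| = 3p$. Let $\pi$ be its permutation character, i.e. the character of the representation of $G$ on $\mathbb{C}^\Omega$ by permutation matrices, so that $\pi(g) = |\{\omega \in \Omega : g\omega = \omega\}|$ for $g \in G$. Then $\pi$ is not of the form $$\pi = 1_G + \chi_1 + 2\chi_2$$ with $1_G$ the principal character and $\chi_1, \chi_2$ irreducible complex characters of $G$ with $\deg\chi_1 = p+1$ and $\deg\chi_2 = p-1$. -/

import Mathlib

/-- `χ` is the character of an irreducible complex representation of `G` of finite degree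
(every such representation can be written by matrices, that is, on some `ℂⁿ`). -/
def IsIrreducibleCharacter {G : Type*} [Group G] (χ : G → ℂ) : Prop :=
  ∃ (n : ℕ) (ρ : Representation ℂ G (Fin n → ℂ)), ρ.IsIrreducible ∧ ρ.character = χ

/-- The permutation character of a permutation group `G` on `Ω`: the trace of the representation
of `G` by permutation matrices, i.e. on the complex vector space with basis `Ω`. -/
noncomputable def permutationCharacter {Ω : Type*} (G : Subgroup (Equiv.Perm Ω)) : G → ℂ :=
  (Representation.ofMulAction ℂ G Ω).character

/-! Suppose π = 1 + χ₁ + 2χ₂ and put d = p - 1. Pairing π with itself gives rank 1 + 1 + 4 = 6, so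
there are five nontrivial orbitals. The adjacency operator of an orbital commutes with G. It acts on
the constants by the valency n, on the χ₁-constituent by a scalar l, and on the 2χ₂-part with two
eigenvalues, each of multiplicity d, whose sum is t.

For d ≥ 3, l is a rational integer: a conjugate y ≠ l would have the same multiplicity as l in the
integral characteristic polynomial, forcing d ∣ 2. Then t is an integer as well, and trace zero
gives n + (d+2)l + dt = 0 for each nontrivial orbital. The l's, including l = 1 on the diagonal, sum
to 0, and Bessel's inequality gives (d+2) ∑ l²/n ≤ 3(d+1) (`exists_orbital_eigenvalues`).

Write n = da - 2l with a = -(l+t). The bound forces a ≥ 0, and the five a's sum to 3, so at least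
two vanish. There n = -2l and l²/n = n/4; since the nontrivial terms sum to less than 2, some n
equals 2 (`exists_subdegree_eq_two`).

In a primitive group a nontrivial subdegree k ≤ 2 is the order of the point stabilizer
(`card_stabilizer_eq_ncard_orbit`), so k = 2 gives |Ω| ≤ 1 + 5·2 = 11 < 3p. For p ≤ 3, counting
yields a subdegree 1, so G is regular and |Ω| is prime, which 3p is not. -/

open Representation Module

/-! ### Character inner products and multiplicities in commuting eigenspaces. -/

section Characters

variable {G : Type*} [Group G] [Fintype G]

/-- The bilinear inner product of class functions, `|G|⁻¹ ∑ f(g) h(g⁻¹)`. -/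
noncomputable def charInner (f h : G → ℂ) : ℂ := (Nat.card G : ℂ)⁻¹ * ∑ g, f g * h g⁻¹

lemma charInner_sum_left {ι : Type*} (s : Finset ι) (f : ι → G → ℂ) (h : G → ℂ) :
    charInner (fun g => ∑ i ∈ s, f i g) h = ∑ i ∈ s, charInner (f i) h := by
  simp only [charInner, Finset.sum_mul, ← Finset.mul_sum]
  rw [Finset.sum_comm]

lemma charInner_smul_left (c : ℂ) (f h : G → ℂ) :
    charInner (fun g => c * f g) h = c * charInner f h := by
  simp only [charInner, Finset.mul_sum]
  exact Finset.sum_congr rfl fun g _ => by ring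

lemma charInner_add_left (f f' h : G → ℂ) :
    charInner (fun g => f g + f' g) h = charInner f h + charInner f' h := by
  simp only [charInner, ← mul_add, ← Finset.sum_add_distrib, add_mul]

lemma charInner_comm (f h : G → ℂ) : charInner f h = charInner h f := by
  simp only [charInner]
  congr 1
  rw [← Equiv.sum_comp (Equiv.inv G)]
  exact Finset.sum_congr rfl fun g _ => by simp [mul_comm]

noncomputable instance : Invertible (Nat.card G : ℂ) :=
  invertibleOfNonzero (Nat.cast_ne_zero.mpr Nat.card_pos.ne')

variable {V W : Type*} [AddCommGroup V] [Module ℂ V] [FiniteDimensional ℂ V]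
  [AddCommGroup W] [Module ℂ W] [FiniteDimensional ℂ W]
  (σ : Representation ℂ G V) (ρ : Representation ℂ G W)

lemma charInner_character :
    charInner σ.character ρ.character = finrank ℂ (IntertwiningMap ρ σ) :=
  card_inv_mul_sum_char_mul_char_eq_finrank ρ σ

lemma charInner_self [ρ.IsIrreducible] : charInner ρ.character ρ.character = 1 := by
  rw [charInner_character]; simp

lemma character_eq_of_charInner_ne_zero [ρ.IsIrreducible] [σ.IsIrreducible]
    (h : charInner σ.character ρ.character ≠ 0) : σ.character = ρ.character := by
  classical
  have := char_orthonormal σ ρ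
  rw [charInner, this] at h
  by_cases hn : Nonempty (Equiv ρ σ)
  · exact (char_iso hn.some).symm
  · simp [hn] at h

lemma IsIrreducibleCharacter.charInner_self {χ : G → ℂ} (h : IsIrreducibleCharacter χ) :
    charInner χ χ = 1 := by
  obtain ⟨n, ρ, hρ, rfl⟩ := h
  exact _root_.charInner_self ρ

lemma IsIrreducibleCharacter.exists_charInner_eq {χ ψ : G → ℂ} (h : IsIrreducibleCharacter χ)
    (h' : IsIrreducibleCharacter ψ) : ∃ n : ℕ, charInner χ ψ = n := by
  obtain ⟨n, ρ, hρ, rfl⟩ := h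
  obtain ⟨m, τ, hτ, rfl⟩ := h'
  exact ⟨_, charInner_character ρ τ⟩

lemma IsIrreducibleCharacter.eq_of_charInner_ne_zero {χ ψ : G → ℂ}
    (h : IsIrreducibleCharacter χ) (h' : IsIrreducibleCharacter ψ) (hne : charInner χ ψ ≠ 0) :
    χ = ψ := by
  obtain ⟨n, ρ, hρ, rfl⟩ := h
  obtain ⟨m, τ, hτ, rfl⟩ := h'
  exact character_eq_of_charInner_ne_zero ρ τ hne

omit [Fintype G] [FiniteDimensional ℂ W] in
lemma isIrreducible_of_finrank_eq_one (h : finrank ℂ W = 1) : ρ.IsIrreducible := by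
  have : Nontrivial W := nontrivial_of_finrank_pos (R := ℂ) (by omega)
  have hs : IsSimpleOrder (Submodule ℂ W) := by
    have := (isSimpleModule_iff_finrank_eq_one (R := ℂ) (M := W)).mpr h
    exact (isSimpleModule_iff _ _).mp this
  refine { exists_pair_ne := ⟨⊥, ⊤, fun hbt => ?_⟩, eq_bot_or_eq_top := fun a => ?_ }
  · have : (⊥ : Submodule ℂ W) = ⊤ := congrArg Subrepresentation.toSubmodule hbt
    exact bot_ne_top this
  · rcases eq_bot_or_eq_top a.toSubmodule with ha | ha
    · exact Or.inl (Subrepresentation.toSubmodule_injective ha)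
    · exact Or.inr (Subrepresentation.toSubmodule_injective ha)

omit [Fintype G] in
lemma isIrreducibleCharacter_one : IsIrreducibleCharacter (fun _ : G => (1 : ℂ)) := by
  refine ⟨1, Representation.trivial ℂ G (Fin 1 → ℂ), isIrreducible_of_finrank_eq_one _ (by simp), ?_⟩
  ext g
  simp [character]

/-- The intertwining inclusion of a subrepresentation. -/
def subrepresentationInclusion {σ : Representation ℂ G V} (E : Subrepresentation σ) :
    IntertwiningMap E.toRepresentation σ where
  toLinearMap := E.toSubmodule.subtype
  isIntertwining' := fun _ => rfl

omit [Fintype G] in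
lemma character_eq_add_of_isCompl {σ : Representation ℂ G V} {E F : Subrepresentation σ}
    (h : IsCompl E.toSubmodule F.toSubmodule) (g : G) :
    σ.character g = E.toRepresentation.character g + F.toRepresentation.character g := by
  have hN : DirectSum.IsInternal (fun b : Bool => if b then E.toSubmodule else F.toSubmodule) :=
    (DirectSum.isInternal_submodule_iff_isCompl _ (i := true) (j := false) (by simp)
      (by ext b; cases b <;> simp)).mpr (by simpa using h)
  have := LinearMap.trace_eq_sum_trace_restrict hN (f := σ g) (by
    rintro (_ | _)
    · exact F.apply_mem_toSubmodule g
    · exact E.apply_mem_toSubmodule g)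
  rw [Fintype.sum_bool] at this
  exact this

/-- Every subrepresentation of a representation whose character is a combination of orthonormal
irreducible characters has such a character as well. -/
theorem exists_character_eq_sum {ι : Type*} [Fintype ι] (χ : ι → G → ℂ)
    (hχ : ∀ j, IsIrreducibleCharacter (χ j)) (m : ι → ℕ) (σ : Representation ℂ G V)
    (hσ : ∀ g, σ.character g = ∑ j, (m j : ℂ) * χ j g) (τ : Representation ℂ G W)
    (f : IntertwiningMap τ σ) (hf : Function.Injective f) :
    ∃ c : ι → ℕ, ∀ g, τ.character g = ∑ j, (c j : ℂ) * χ j g := by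
  classical
  induction hn : finrank ℂ W using Nat.strong_induction_on generalizing W with
  | _ n ih =>
  subst hn
  rcases subsingleton_or_nontrivial W with hW | hW
  · refine ⟨0, fun g => ?_⟩
    have : τ g = 0 := LinearMap.ext fun w => Subsingleton.elim _ _
    simp [character, this]
  by_cases hirr : τ.IsIrreducible
  -- The nonzero map `f` makes τ pair nontrivially with σ, hence with some `χ j`; irreducible
  -- characters that pair nontrivially are equal.
  · have h1 : charInner σ.character τ.character ≠ 0 := by
      rw [charInner_character, Nat.cast_ne_zero]
      have : Nontrivial (IntertwiningMap τ σ) := by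
        refine ⟨f, 0, fun h0 => ?_⟩
        obtain ⟨w, hw⟩ := exists_ne (0 : W)
        exact hw (hf (by rw [h0]; simp))
      exact finrank_pos.ne'
    have h2 : σ.character = fun g => ∑ j, (m j : ℂ) * χ j g := funext hσ
    rw [h2, charInner_sum_left] at h1
    obtain ⟨j, -, hj⟩ := Finset.exists_ne_zero_of_sum_ne_zero h1
    rw [charInner_smul_left] at hj
    obtain ⟨k, ρ, hρ, hk⟩ := hχ j
    have h3 : τ.character = χ j := by
      rw [← hk, character_eq_of_charInner_ne_zero ρ τ]
      rw [hk]
      exact right_ne_zero_of_mul hj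
    exact ⟨Pi.single j 1, fun g => by simp [h3, Pi.single_apply]⟩
  · have hnt : Nontrivial (Subrepresentation τ) := by
      refine ⟨⊥, ⊤, fun hbt => ?_⟩
      have : (⊥ : Submodule ℂ W) = ⊤ := congrArg Subrepresentation.toSubmodule hbt
      exact bot_ne_top this
    obtain ⟨E, hE0, hE1⟩ : ∃ E : Subrepresentation τ, E ≠ ⊥ ∧ E ≠ ⊤ := by
      by_contra! hcon
      exact hirr { eq_bot_or_eq_top := fun a => or_iff_not_imp_left.mpr (hcon a) }
    -- Maschke's theorem; both summands have smaller dimension and still embed in σ.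
    obtain ⟨F, hF⟩ := exists_isCompl E
    have hc : IsCompl E.toSubmodule F.toSubmodule := by
      rw [isCompl_iff, disjoint_iff, codisjoint_iff] at hF ⊢
      exact ⟨congrArg Subrepresentation.toSubmodule hF.1,
        congrArg Subrepresentation.toSubmodule hF.2⟩
    have hE0' : E.toSubmodule ≠ ⊥ := fun h => hE0 (Subrepresentation.toSubmodule_injective h)
    have hE1' : E.toSubmodule ≠ ⊤ := fun h => hE1 (Subrepresentation.toSubmodule_injective h)
    have hF1' : F.toSubmodule ≠ ⊤ := fun h => hE0' (by
      have := hc.inf_eq_bot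
      rwa [h, inf_top_eq] at this)
    obtain ⟨a, ha⟩ := ih _ (Submodule.finrank_lt hE1') E.toRepresentation
      (f.comp (subrepresentationInclusion E)) (hf.comp Subtype.val_injective) rfl
    obtain ⟨b, hb⟩ := ih _ (Submodule.finrank_lt hF1') F.toRepresentation
      (f.comp (subrepresentationInclusion F)) (hf.comp Subtype.val_injective) rfl
    refine ⟨a + b, fun g => ?_⟩
    rw [character_eq_add_of_isCompl hc, ha, hb, ← Finset.sum_add_distrib]
    exact Finset.sum_congr rfl fun j _ => by simp [add_mul]

lemma charInner_sum_orthonormal {ι : Type*} [Fintype ι] [DecidableEq ι] {χ : ι → G → ℂ}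
    (horth : ∀ i j, charInner (χ i) (χ j) = if i = j then 1 else 0) (m : ι → ℂ) (j : ι) :
    charInner (fun g => ∑ i, m i * χ i g) (χ j) = m j := by
  rw [charInner_sum_left]
  simp [charInner_smul_left, horth]

/-- The generalized eigenspaces of an endomorphism commuting with a representation, as
subrepresentations. -/
noncomputable def genEigenspaceSubrep {σ : Representation ℂ G V} (T : Module.End ℂ V)
    (hT : ∀ g, Commute T (σ g)) (μ : ℂ) : Subrepresentation σ where
  toSubmodule := T.maxGenEigenspace μ
  apply_mem_toSubmodule g _ hv := T.mapsTo_maxGenEigenspace_of_comm (hT g) μ hv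

/-- The multiplicities of the irreducible characters in the generalized eigenspaces of an
endomorphism commuting with a representation. -/
theorem exists_eigenspace_multiplicities {ι : Type*} [Fintype ι] [DecidableEq ι]
    (χ : ι → G → ℂ) (hχ : ∀ j, IsIrreducibleCharacter (χ j))
    (horth : ∀ i j, charInner (χ i) (χ j) = if i = j then 1 else 0) (m : ι → ℕ)
    (σ : Representation ℂ G V) (hσ : ∀ g, σ.character g = ∑ j, (m j : ℂ) * χ j g)
    (T : Module.End ℂ V) (hT : ∀ g, Commute T (σ g)) :
    ∃ (c : ℂ → ι → ℕ) (s : Finset ℂ), (∀ μ, μ ∉ s → c μ = 0) ∧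
      (∀ μ ∈ s, T.charpoly.IsRoot μ) ∧
      (∀ μ g, (genEigenspaceSubrep T hT μ).toRepresentation.character g =
        ∑ j, (c μ j : ℂ) * χ j g) ∧
      (∀ j, ∑ μ ∈ s, c μ j = m j) := by
  classical
  have hN : DirectSum.IsInternal (fun μ => T.maxGenEigenspace μ) :=
    DirectSum.isInternal_submodule_of_iSupIndep_of_iSup_eq_top T.independent_maxGenEigenspace
      (Module.End.iSup_maxGenEigenspace_eq_top T)
  have hfin : {μ | T.maxGenEigenspace μ ≠ ⊥}.Finite :=
    WellFoundedGT.finite_ne_bot_of_iSupIndep T.independent_maxGenEigenspace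
  have h := fun μ => exists_character_eq_sum χ hχ m σ hσ
    (genEigenspaceSubrep T hT μ).toRepresentation
    (subrepresentationInclusion _) Subtype.val_injective
  choose c hc using h
  have hinner : ∀ μ j, charInner (genEigenspaceSubrep T hT μ).toRepresentation.character (χ j) =
      c μ j := fun μ j => by
    rw [funext (hc μ), charInner_sum_orthonormal horth]
  refine ⟨c, hfin.toFinset, fun μ hμ => ?_, fun μ hμ => ?_, hc, fun j => ?_⟩
  · ext j
    have h0 : T.maxGenEigenspace μ = ⊥ := by simpa using hμ
    have : (genEigenspaceSubrep T hT μ).toRepresentation.character = fun g => 0 * (1 : ℂ) := by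
      ext g
      have : Subsingleton (T.maxGenEigenspace μ) := by rw [h0]; infer_instance
      have : (genEigenspaceSubrep T hT μ).toRepresentation g = 0 :=
        LinearMap.ext fun w => Subsingleton.elim (α := T.maxGenEigenspace μ) _ _
      simp [character, this]
    have h2 := hinner μ j
    rw [this, charInner_smul_left, zero_mul] at h2
    exact_mod_cast h2.symm
  · have h0 : T.maxGenEigenspace μ ≠ ⊥ := by simpa using hμ
    have h1 := T.finrank_maxGenEigenspace_eq μ
    have h2 : finrank ℂ (T.maxGenEigenspace μ) ≠ 0 := by
      rwa [Ne, Submodule.finrank_eq_zero]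
    rw [h1] at h2
    by_contra hr
    exact h2 (Polynomial.rootMultiplicity_eq_zero hr)
  -- V is the direct sum of the generalized eigenspaces; pairing the resulting sum of characters
  -- with `χ j` adds up multiplicities.
  · have h1 : σ.character = fun g => ∑ μ ∈ hfin.toFinset,
        (genEigenspaceSubrep T hT μ).toRepresentation.character g := by
      ext g
      exact LinearMap.trace_eq_sum_trace_restrict' hN hfin (f := σ g)
        (fun μ => T.mapsTo_maxGenEigenspace_of_comm (hT g) μ)
    have h2 : charInner σ.character (χ j) = m j := by
      rw [funext hσ, charInner_sum_orthonormal horth]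
    rw [h1, charInner_sum_left] at h2
    simp only [hinner] at h2
    exact_mod_cast h2

/-- A nonzero intertwining map from an irreducible representation into the `μ`-eigenspace forces a
positive multiplicity. -/
lemma eigenspace_multiplicity_ne_zero {ι : Type*} [Fintype ι] [DecidableEq ι]
    {χ : ι → G → ℂ} (horth : ∀ i j, charInner (χ i) (χ j) = if i = j then 1 else 0)
    {σ : Representation ℂ G V} (T : Module.End ℂ V) (hT : ∀ g, Commute T (σ g)) (μ : ℂ)
    (c : ι → ℕ) (hc : ∀ g, (genEigenspaceSubrep T hT μ).toRepresentation.character g =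
        ∑ j, (c j : ℂ) * χ j g)
    (ρ : Representation ℂ G W) (j : ι) (hρ : ρ.character = χ j) (f : IntertwiningMap ρ σ)
    (hf : f ≠ 0) (hfμ : ∀ w, T (f w) = μ • f w) : c j ≠ 0 := by
  have hmem : ∀ w, f w ∈ T.maxGenEigenspace μ := fun w =>
    T.genEigenspace_le_maximal μ 1 (Module.End.mem_eigenspace_iff.mpr (hfμ w))
  let f' : IntertwiningMap ρ (genEigenspaceSubrep T hT μ).toRepresentation :=
    { toLinearMap := f.toLinearMap.codRestrict _ hmem
      isIntertwining' := fun g => by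
        ext w
        exact f.isIntertwining _ _ g w }
  have hf' : f' ≠ 0 := fun h0 => hf (by
    ext w
    exact congrArg Subtype.val (DFunLike.congr_fun h0 w))
  have h1 := charInner_character (genEigenspaceSubrep T hT μ).toRepresentation ρ
  rw [hρ, funext hc, charInner_sum_orthonormal horth] at h1
  have : Nontrivial (IntertwiningMap ρ (genEigenspaceSubrep T hT μ).toRepresentation) :=
    ⟨f', 0, hf'⟩
  rw [Nat.cast_inj.mp h1]
  exact finrank_pos.ne'

end Characters

/-! ### Spectrum of an operator commuting with a representation of character 1 + χ₁ + 2χ₂. -/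

section Spectral

variable {G : Type*} [Group G] [Fintype G]
variable {V : Type*} [AddCommGroup V] [Module ℂ V] [FiniteDimensional ℂ V]

/-- The root multiplicities of the characteristic polynomial, and the trace, of an endomorphism
commuting with a representation of character `1 + χ₁ + 2χ₂`. -/
theorem exists_rootMultiplicity_charpoly_eq {χ₁ χ₂ : G → ℂ}
    (h₁ : IsIrreducibleCharacter χ₁) (h₂ : IsIrreducibleCharacter χ₂) {d₁ d₂ : ℕ}
    (hd₁ : χ₁ 1 = d₁) (hd₂ : χ₂ 1 = d₂)
    (h01 : charInner 1 χ₁ = 0) (h02 : charInner 1 χ₂ = 0) (h12 : charInner χ₁ χ₂ = 0)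
    (σ : Representation ℂ G V) (hσ : ∀ g, σ.character g = 1 + χ₁ g + 2 * χ₂ g)
    {W₀ W₁ : Type*} [AddCommGroup W₀] [Module ℂ W₀] [FiniteDimensional ℂ W₀]
    [AddCommGroup W₁] [Module ℂ W₁] [FiniteDimensional ℂ W₁]
    (ρ₀ : Representation ℂ G W₀) (ρ₁ : Representation ℂ G W₁) (hρ₀ : ρ₀.character = 1)
    (hρ₁ : ρ₁.character = χ₁) (f₀ : IntertwiningMap ρ₀ σ) (f₁ : IntertwiningMap ρ₁ σ)
    (hf₀ : f₀ ≠ 0) (hf₁ : f₁ ≠ 0)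
    (T : Module.End ℂ V) (hT : ∀ g, Commute T (σ g)) (n l : ℂ)
    (hn : ∀ w, T (f₀ w) = n • f₀ w) (hl : ∀ w, T (f₁ w) = l • f₁ w) :
    ∃ (c : ℂ → ℕ) (s : Finset ℂ), (∀ μ ∈ s, T.charpoly.IsRoot μ) ∧
      (∀ μ, T.charpoly.rootMultiplicity μ =
        (if μ = n then 1 else 0) + d₁ * (if μ = l then 1 else 0) + d₂ * c μ) ∧
      LinearMap.trace ℂ V T = n + d₁ * l + d₂ * ∑ μ ∈ s, c μ * μ := by
  classical
  let χ : Fin 3 → G → ℂ := ![1, χ₁, χ₂]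
  have hχ : ∀ j, IsIrreducibleCharacter (χ j) := by
    intro j
    fin_cases j
    · exact isIrreducibleCharacter_one
    · exact h₁
    · exact h₂
  have horth : ∀ i j, charInner (χ i) (χ j) = if i = j then 1 else 0 := by
    intro i j
    fin_cases i <;> fin_cases j
    · exact (hχ 0).charInner_self
    · exact h01
    · exact h02
    · exact (charInner_comm _ _).trans h01
    · exact (hχ 1).charInner_self
    · exact h12
    · exact (charInner_comm _ _).trans h02
    · exact (charInner_comm _ _).trans h12
    · exact (hχ 2).charInner_self
  obtain ⟨c, s, hs, hroot, hc, hsum⟩ := exists_eigenspace_multiplicities χ hχ horth ![1, 1, 2] σ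
    (fun g => by simp [Fin.sum_univ_three, hσ, χ]) T hT
  -- A constituent of multiplicity one lies in a single generalized eigenspace, the one where it is
  -- known to occur.
  have hmult (j : Fin 3) (hj : ∑ μ ∈ s, c μ j = 1) (x : ℂ) (hx : c x j ≠ 0) (μ : ℂ) :
      c μ j = if μ = x then 1 else 0 := by
    have hxs : x ∈ s := by
      by_contra hxs
      simp [hs x hxs] at hx
    rw [← Finset.add_sum_erase s _ hxs] at hj
    have hx1 : c x j = 1 := by omega
    have h0 : ∑ μ ∈ s.erase x, c μ j = 0 := by omega
    rw [Finset.sum_eq_zero_iff] at h0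
    split_ifs with h
    · rw [h, hx1]
    · by_cases hμ : μ ∈ s
      · exact h0 μ (Finset.mem_erase.mpr ⟨h, hμ⟩)
      · simp [hs μ hμ]
  have hc0 := hmult 0 (hsum 0) n
    (eigenspace_multiplicity_ne_zero horth T hT n (c n) (hc n) ρ₀ 0 hρ₀ f₀ hf₀ hn)
  have hc1 := hmult 1 (hsum 1) l
    (eigenspace_multiplicity_ne_zero horth T hT l (c l) (hc l) ρ₁ 1 hρ₁ f₁ hf₁ hl)
  have hmul : ∀ μ, T.charpoly.rootMultiplicity μ = c μ 0 + d₁ * c μ 1 + d₂ * c μ 2 := by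
    intro μ
    rw [← T.finrank_maxGenEigenspace_eq μ]
    have := hc μ 1
    rw [char_one, Fin.sum_univ_three] at this
    simp only [χ, Matrix.cons_val_zero, Matrix.cons_val_one, Matrix.cons_val, Pi.one_apply, hd₁,
      hd₂] at this
    have h' : (finrank ℂ (T.maxGenEigenspace μ) : ℂ) =
      ((c μ 0 + d₁ * c μ 1 + d₂ * c μ 2 : ℕ) : ℂ) := by
      refine Eq.trans this ?_
      push_cast
      ring
    exact_mod_cast h'
  have hns : n ∈ s := by
    by_contra h
    have := hc0 n
    simp [hs n h] at this
  have hls : l ∈ s := by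
    by_contra h
    have := hc1 l
    simp [hs l h] at this
  refine ⟨fun μ => c μ 2, s, hroot, fun μ => by rw [hmul, hc0, hc1], ?_⟩
  have hsub : s ⊆ T.charpoly.roots.toFinset := fun μ hμ => by
    rw [Multiset.mem_toFinset, Polynomial.mem_roots T.charpoly_monic.ne_zero]
    exact hroot μ hμ
  have htr : LinearMap.trace ℂ V T = ∑ μ ∈ s, (T.charpoly.rootMultiplicity μ : ℂ) * μ := by
    rw [Module.End.trace_eq_sum_roots_charpoly_of_splits (IsAlgClosed.splits _), Finset.sum_multiset_count]
    rw [← Finset.sum_subset hsub]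
    · exact Finset.sum_congr rfl fun μ _ => by simp [Polynomial.count_roots]
    · intro μ _ hμ
      rw [Polynomial.count_roots, hmul, hs μ hμ]
      simp
  rw [htr]
  simp only [hmul, hc0, hc1, Nat.cast_add, Nat.cast_mul, add_mul, Finset.sum_add_distrib, mul_assoc,
    ← Finset.mul_sum]
  simp [hns, hls]

end Spectral

/-! ### Conjugate roots and integrality of eigenvalues. -/

section Conjugates

open Polynomial

/-- Both multiplicities equal the exponent of the common minimal polynomial in P: that polynomial is
separable, so its roots are simple, and the cofactor vanishes at none of them. -/
lemma rootMultiplicity_map_eq_of_isConjRoot (P : ℚ[X]) {x y : ℂ} (hx : IsIntegral ℚ x)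
    (hxy : IsConjRoot ℚ x y) :
    (P.map (algebraMap ℚ ℂ)).rootMultiplicity x = (P.map (algebraMap ℚ ℂ)).rootMultiplicity y := by
  rcases eq_or_ne P 0 with rfl | hP
  · simp
  have hirr := minpoly.irreducible hx
  obtain ⟨Q, hQ, hnd⟩ := (FiniteMultiplicity.of_not_isUnit hirr.not_isUnit hP
    ).exists_eq_pow_mul_and_not_dvd
  set k := multiplicity (minpoly ℚ x) P
  have key : ∀ z : ℂ, minpoly ℚ z = minpoly ℚ x →
      (P.map (algebraMap ℚ ℂ)).rootMultiplicity z = k := by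
    intro z hz
    have h1 : ((minpoly ℚ x).map (algebraMap ℚ ℂ)).rootMultiplicity z = 1 := by
      apply le_antisymm
      · exact rootMultiplicity_le_one_of_separable hirr.separable.map z
      · rw [Nat.one_le_iff_ne_zero, ← Nat.pos_iff_ne_zero, rootMultiplicity_pos
          (map_ne_zero (minpoly.ne_zero hx)), ← hz, IsRoot, eval_map_algebraMap, minpoly.aeval]
    have h2 : (Q.map (algebraMap ℚ ℂ)).rootMultiplicity z = 0 := by
      apply rootMultiplicity_eq_zero
      rw [IsRoot, eval_map_algebraMap]
      intro h
      exact hnd (hz ▸ minpoly.dvd ℚ z h)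
    rw [← count_roots] at h1 h2 ⊢
    have hne : P.map (algebraMap ℚ ℂ) ≠ 0 := map_ne_zero hP
    rw [hQ, Polynomial.map_mul, Polynomial.map_pow] at hne ⊢
    rw [roots_mul hne, roots_pow, Multiset.count_add, Multiset.count_nsmul, h1, h2]
    simp
  rw [key x rfl, key y hxy.symm]

/-- An algebraic integer outside ℤ is irrational, so its separable minimal polynomial has another
root. That root is no integer z either, or the minimal polynomial would be X - z. -/
lemma exists_isConjRoot_ne_of_forall_ne_intCast {x : ℂ} (hx : IsIntegral ℤ x)
    (h : ∀ z : ℤ, x ≠ z) :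
    ∃ y, x ≠ y ∧ IsConjRoot ℚ x y ∧ ∀ z : ℤ, y ≠ z := by
  have hxQ : IsIntegral ℚ x := hx.tower_top
  have hnot : x ∉ (⊥ : Subalgebra ℚ ℂ) := by
    rintro ⟨q, hq⟩
    have hq' : (algebraMap ℚ ℂ) q = x := hq
    rw [← hq', isIntegral_algebraMap_iff (algebraMap ℚ ℂ).injective] at hx
    obtain ⟨z, hz⟩ := IsIntegrallyClosed.isIntegral_iff.mp hx
    apply h z
    rw [← hq', ← hz]
    simp
  obtain ⟨y, hne, hy⟩ := (notMem_iff_exists_ne_and_isConjRoot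
    (minpoly.irreducible hxQ).separable (IsAlgClosed.splits _)).mp hnot
  refine ⟨y, hne, hy, fun z hz => hnot ?_⟩
  have hm : minpoly ℚ x = X - C (z : ℚ) := by
    rw [show minpoly ℚ x = minpoly ℚ y from hy, hz]
    simpa using minpoly.eq_X_sub_C ℂ (z : ℚ)
  have := minpoly.aeval ℚ x
  rw [hm] at this
  refine ⟨(z : ℚ), ?_⟩
  simp only [map_sub, aeval_X, aeval_C] at this
  exact (sub_eq_zero.mp this).symm

/-- If the multiplicities of the roots of an integer polynomial have the shape found in
`exists_rootMultiplicity_charpoly_eq` with degrees `p + 1` and `p - 1`, then the distinguished root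
is an integer. -/
lemma exists_intCast_eq_of_rootMultiplicity {P : ℤ[X]} (hP : P.Monic) {d : ℕ} (hd : 3 ≤ d)
    (n : ℤ) (l : ℂ) (c : ℂ → ℕ)
    (h : ∀ μ, (P.map (Int.castRingHom ℂ)).rootMultiplicity μ =
        (if μ = n then 1 else 0) + (d + 2) * (if μ = l then 1 else 0) + d * c μ) :
    ∃ z : ℤ, l = z := by
  by_contra! hcon
  have hroot : ∀ μ, (P.map (Int.castRingHom ℂ)).IsRoot μ → IsIntegral ℤ μ := fun μ hμ =>
    ⟨P, hP, by rwa [IsRoot, eval_map] at hμ⟩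
  have hl : IsIntegral ℤ l := by
    apply hroot
    by_contra hr
    have := h l
    rw [rootMultiplicity_eq_zero hr, if_pos rfl] at this
    omega
  obtain ⟨y, hne, hy, hyz⟩ := exists_isConjRoot_ne_of_forall_ne_intCast hl hcon
  have hmap : P.map (Int.castRingHom ℂ) = (P.map (Int.castRingHom ℚ)).map (algebraMap ℚ ℂ) := by
    rw [Polynomial.map_map]
    congr 1
  have heq := rootMultiplicity_map_eq_of_isConjRoot (P.map (Int.castRingHom ℚ)) hl.tower_top hy
  rw [← hmap, h, h, if_neg (hcon n), if_pos rfl, if_neg (hyz n), if_neg hne.symm] at heq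
  -- Equal multiplicities at `l` and `y` read d + 2 + d·c(l) = d·c(y).
  have hdvd : d ∣ 2 := by
    have h1 : d ∣ d * c y := dvd_mul_right _ _
    have h2 : d * c y = d * (1 + c l) + 2 := by rw [mul_add]; omega
    rw [h2] at h1
    exact (Nat.dvd_add_right (dvd_mul_right _ _)).mp h1
  have := Nat.le_of_dvd (by norm_num) hdvd
  omega

lemma exists_intCast_eq_of_mul_eq_intCast {t : ℂ} (ht : IsIntegral ℤ t) {d : ℕ} (hd : d ≠ 0) (a : ℤ)
    (h : (d : ℂ) * t = a) : ∃ z : ℤ, t = z := by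
  have ht' : t = algebraMap ℚ ℂ ((a : ℚ) / d) := by
    have : (d : ℂ) ≠ 0 := Nat.cast_ne_zero.mpr hd
    rw [map_div₀]
    simp only [map_intCast, map_natCast]
    rw [← h]
    field_simp
  rw [ht', isIntegral_algebraMap_iff (algebraMap ℚ ℂ).injective] at ht
  obtain ⟨z, hz⟩ := IsIntegrallyClosed.isIntegral_iff.mp ht
  refine ⟨z, ?_⟩
  rw [ht', ← hz]
  simp

end Conjugates

/-! ### The permutation representation and orbit counting. -/

section PermutationRepresentation

variable {G Ω : Type*} [Group G] [MulAction G Ω]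

variable (G Ω) in
/-- The permutation representation on functions. -/
def permRep : Representation ℂ G (Ω → ℂ) where
  toFun g := LinearMap.funLeft ℂ ℂ (g⁻¹ • · : Ω → Ω)
  map_one' := by ext; simp
  map_mul' g h := by
    refine LinearMap.ext fun f => funext fun x => ?_
    simp [LinearMap.funLeft_apply, mul_smul]

lemma permRep_apply (g : G) (f : Ω → ℂ) (x : Ω) : permRep G Ω g f x = f (g⁻¹ • x) := rfl

variable [Fintype Ω]

lemma character_ofMulAction_eq_permRep :
    (ofMulAction ℂ G Ω).character = (permRep G Ω).character := by
  refine char_iso (Representation.Equiv.mk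
    ((MonoidAlgebra.coeffLinearEquiv ℂ).trans (Finsupp.linearEquivFunOnFinite ℂ ℂ Ω)) fun g => ?_)
  refine LinearMap.ext fun f => funext fun x => ?_
  exact coeff_ofMulAction g f x

lemma permRep_character (g : G) :
    (permRep G Ω).character g = Nat.card (MulAction.fixedBy Ω g) := by
  classical
  rw [Nat.card_eq_fintype_card, character, LinearMap.trace_eq_matrix_trace ℂ (Pi.basisFun ℂ Ω), Matrix.trace,
    Fintype.card_subtype]
  simp only [Matrix.diag_apply, LinearMap.toMatrix_apply, Pi.basisFun_apply, Pi.basisFun_repr,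
    permRep_apply, Pi.single_apply, Finset.sum_boole]
  congr 2
  ext x
  simp only [Finset.mem_filter, Finset.mem_univ, true_and, MulAction.mem_fixedBy]
  rw [inv_smul_eq_iff, eq_comm]

lemma permRep_character_inv (g : G) :
    (permRep G Ω).character g⁻¹ = (permRep G Ω).character g := by
  simp only [permRep_character, MulAction.fixedBy_inv]

variable [Fintype G]

lemma charInner_permRep_one :
    charInner (permRep G Ω).character 1 = Nat.card (MulAction.orbitRel.Quotient G Ω) := by
  classical
  have := MulAction.sum_card_fixedBy_eq_card_orbits_mul_card_group G Ω
  have h := congrArg (Nat.cast : ℕ → ℂ) this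
  push_cast at h
  simp only [charInner, permRep_character, Pi.one_apply, mul_one, Nat.card_eq_fintype_card] at h ⊢
  rw [h]
  field_simp

/-- Since π(g⁻¹) = π(g) and π² is the permutation character of Ω × Ω, Burnside's orbit count gives
the rank. -/
lemma charInner_permRep_self : charInner (permRep G Ω).character (permRep G Ω).character =
    Nat.card (MulAction.orbitRel.Quotient G (Ω × Ω)) := by
  classical
  rw [← charInner_permRep_one]
  simp only [charInner, permRep_character_inv]
  congr 1
  refine Finset.sum_congr rfl fun g _ => ?_
  rw [permRep_character, permRep_character, Pi.one_apply, mul_one, ← Nat.cast_mul,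
    ← Nat.card_prod]
  congr 1
  refine Nat.card_congr
    { toFun := fun x => ⟨(x.1.1, x.2.1), Prod.ext x.1.2 x.2.2⟩
      invFun := fun x => (⟨x.1.1, congrArg Prod.fst x.2⟩, ⟨x.1.2, congrArg Prod.snd x.2⟩)
      left_inv := fun _ => rfl
      right_inv := fun _ => rfl }

omit [Fintype G] in
lemma commute_toLin'_permRep [DecidableEq Ω] (M : Matrix Ω Ω ℂ)
    (hM : ∀ (g : G) x y, M (g • x) (g • y) = M x y) (g : G) :
    Commute (Matrix.toLin' M) (permRep G Ω g) := by
  refine LinearMap.ext fun f => funext fun x => ?_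
  simp only [Module.End.mul_apply, Matrix.toLin'_apply, permRep_apply, Matrix.mulVec, dotProduct]
  rw [← Equiv.sum_comp (MulAction.toPerm g)]
  refine Finset.sum_congr rfl fun y _ => ?_
  have := hM g (g⁻¹ • x) y
  rw [smul_inv_smul] at this
  simp [this]

variable (G Ω) in
/-- The embedding of the trivial representation as the constant functions. -/
def constIntertwining : IntertwiningMap (Representation.trivial ℂ G ℂ) (permRep G Ω) where
  toLinearMap := LinearMap.pi fun _ => LinearMap.id
  isIntertwining' := fun _ => rfl

-- T ∘ f is again intertwining, hence a multiple of f in a one-dimensional space of intertwining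
-- maps.
omit [Fintype G] in
lemma exists_eigenvalue_of_finrank_eq_one {V W : Type*} [AddCommGroup V] [Module ℂ V]
    [AddCommGroup W] [Module ℂ W]
    {ρ : Representation ℂ G W} {σ : Representation ℂ G V}
    (h : finrank ℂ (IntertwiningMap ρ σ) = 1) {f : IntertwiningMap ρ σ} (hf : f ≠ 0)
    (T : Module.End ℂ V) (hT : ∀ g, Commute T (σ g)) :
    ∃ l : ℂ, ∀ w, T (f w) = l • f w := by
  let Tf : IntertwiningMap ρ σ :=
    { toLinearMap := T ∘ₗ f.toLinearMap
      isIntertwining' := fun g => by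
        ext w
        have := LinearMap.congr_fun (hT g) (f w)
        simp only [Module.End.mul_apply] at this
        simpa [f.isIntertwining] using this }
  obtain ⟨l, hl⟩ := (finrank_eq_one_iff_of_nonzero' f hf).mp h Tf
  exact ⟨l, fun w => (DFunLike.congr_fun hl w).symm⟩

end PermutationRepresentation

/-! ### A Hilbert–Schmidt lower bound from an eigenspace. -/

section Bessel

/-- If a matrix acts as the scalar `s` on a space of dimension `d`, then the sum of the squares of
the moduli of its entries is at least `d * |s|²`. -/
lemma finrank_mul_sq_le_sum_sq {Ω W : Type*} [Fintype Ω] [AddCommGroup W] [Module ℂ W]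
    [FiniteDimensional ℂ W] (f : W →ₗ[ℂ] (Ω → ℂ)) (hf : Function.Injective f)
    (M : Matrix Ω Ω ℂ) (s : ℂ) (hM : ∀ w, M.mulVec (f w) = s • f w) :
    finrank ℂ W * ‖s‖ ^ 2 ≤ ∑ x, ∑ y, ‖M x y‖ ^ 2 := by
  let F : W →ₗ[ℂ] EuclideanSpace ℂ Ω := (WithLp.linearEquiv 2 ℂ (Ω → ℂ)).symm.toLinearMap ∘ₗ f
  have hF : Function.Injective F := (WithLp.linearEquiv 2 ℂ (Ω → ℂ)).symm.injective.comp hf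
  let U := LinearMap.range F
  have hd : finrank ℂ U = finrank ℂ W := LinearMap.finrank_range_of_inj hF
  let b := stdOrthonormalBasis ℂ U
  have hb : Orthonormal ℂ (fun k => (b k : EuclideanSpace ℂ Ω)) :=
    b.orthonormal.comp_linearIsometry U.subtypeₗᵢ
  -- Rows are conjugated because the inner product is conjugate-linear on the left; pairing `r x`
  -- with v gives (Mv)(x).
  let r : Ω → EuclideanSpace ℂ Ω := fun x => WithLp.toLp 2 fun y => star (M x y)
  have hr : ∀ x k, inner ℂ (r x) (b k : EuclideanSpace ℂ Ω) =
      s * (b k : EuclideanSpace ℂ Ω) x := by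
    intro x k
    obtain ⟨w, hw⟩ := (b k).2
    have h := congrFun (hM w) x
    rw [← hw]
    simp only [PiLp.inner_apply, RCLike.inner_apply]
    rw [Matrix.mulVec, dotProduct] at h
    refine Eq.trans (Finset.sum_congr rfl fun y _ => ?_) h
    simp [r, F, mul_comm]
  calc (finrank ℂ W : ℝ) * ‖s‖ ^ 2
      = ∑ k, ‖s‖ ^ 2 * ‖(b k : EuclideanSpace ℂ Ω)‖ ^ 2 := by
        simp only [hb.norm_eq_one]
        simp [hd]
    _ = ∑ k, ∑ x, ‖inner ℂ (b k : EuclideanSpace ℂ Ω) (r x)‖ ^ 2 := by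
        refine Finset.sum_congr rfl fun k _ => ?_
        rw [EuclideanSpace.norm_sq_eq, Finset.mul_sum]
        refine Finset.sum_congr rfl fun x _ => ?_
        rw [norm_inner_symm, hr, norm_mul, mul_pow]
    _ = ∑ x, ∑ k, ‖inner ℂ (b k : EuclideanSpace ℂ Ω) (r x)‖ ^ 2 := Finset.sum_comm
    _ ≤ ∑ x, ‖r x‖ ^ 2 := Finset.sum_le_sum fun x _ => hb.sum_inner_products_le (r x)
    _ = ∑ x, ∑ y, ‖M x y‖ ^ 2 := by
        refine Finset.sum_congr rfl fun x _ => ?_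
        rw [EuclideanSpace.norm_sq_eq]
        simp [r]

end Bessel

/-! ### Orbitals, their valencies and adjacency operators. -/

section Orbitals

variable (G : Type*) {Ω : Type*} [Group G] [MulAction G Ω]

/-- The orbital containing `(x, y)`. -/
def orbital (x y : Ω) : MulAction.orbitRel.Quotient G (Ω × Ω) := Quotient.mk'' (x, y)

lemma orbital_eq_iff {x y x' y' : Ω} :
    orbital G x y = orbital G x' y' ↔ ∃ g : G, g • x' = x ∧ g • y' = y := by
  rw [orbital, orbital, Quotient.eq'', MulAction.orbitRel_apply, MulAction.mem_orbit_iff]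
  simp [Prod.ext_iff]

variable {G}

lemma orbital_smul_smul (g : G) (x y : Ω) : orbital G (g • x) (g • y) = orbital G x y :=
  (orbital_eq_iff G).mpr ⟨g, rfl, rfl⟩

lemma orbital_eq_iff_mem_orbit {x y z : Ω} :
    orbital G x y = orbital G x z ↔ y ∈ MulAction.orbit (MulAction.stabilizer G x) z := by
  rw [orbital_eq_iff, MulAction.mem_orbit_iff]
  exact ⟨fun ⟨g, h1, h2⟩ => ⟨⟨g, h1⟩, h2⟩, fun ⟨⟨g, h1⟩, h2⟩ => ⟨g, h1, h2⟩⟩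

lemma orbital_eq_diagonal_iff [MulAction.IsPretransitive G Ω] {x y z : Ω} :
    orbital G x y = orbital G z z ↔ x = y := by
  rw [orbital_eq_iff]
  constructor
  · rintro ⟨g, rfl, rfl⟩
    rfl
  · rintro rfl
    obtain ⟨g, hg⟩ := MulAction.exists_smul_eq G z x
    exact ⟨g, hg, hg⟩

variable (o : MulAction.orbitRel.Quotient G (Ω × Ω))

/-- The valency of the orbital `o` at the point `x`. -/
noncomputable def valency (x : Ω) : ℕ := Nat.card {y // orbital G x y = o}

lemma valency_eq [MulAction.IsPretransitive G Ω] (x x' : Ω) : valency o x = valency o x' := by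
  obtain ⟨g, rfl⟩ := MulAction.exists_smul_eq G x' x
  refine (Nat.card_congr ((MulAction.toPerm g).subtypeEquiv fun y => ?_)).symm
  simp [orbital_smul_smul]

lemma exists_orbital_eq [MulAction.IsPretransitive G Ω] (x : Ω) : ∃ y, orbital G x y = o := by
  induction o using Quotient.inductionOn' with
  | _ ab =>
    obtain ⟨a, b⟩ := ab
    obtain ⟨g, hg⟩ := MulAction.exists_smul_eq G a x
    exact ⟨g • b, by rw [← hg]; exact orbital_smul_smul g a b⟩

lemma valency_pos [Finite Ω] [MulAction.IsPretransitive G Ω] (x : Ω) : 0 < valency o x := by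
  obtain ⟨y, hy⟩ := exists_orbital_eq o x
  have : Nonempty {y // orbital G x y = o} := ⟨⟨y, hy⟩⟩
  exact Nat.card_pos

lemma valency_orbital (x y : Ω) :
    valency (orbital G x y) x = (MulAction.orbit (MulAction.stabilizer G x) y).ncard := by
  rw [valency]
  simp only [orbital_eq_iff_mem_orbit]
  rfl

lemma valency_diagonal [MulAction.IsPretransitive G Ω] (x z : Ω) :
    valency (orbital G z z) x = 1 := by
  rw [valency]
  simp only [orbital_eq_diagonal_iff]
  simp

section Matrices

variable [Fintype Ω]

open Classical in
lemma valency_eq_card_filter (x : Ω) :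
    valency o x = (Finset.univ.filter fun y => orbital G x y = o).card := by
  rw [valency, Nat.card_eq_fintype_card, Fintype.card_subtype]

lemma sum_valency_mul [Fintype (MulAction.orbitRel.Quotient G (Ω × Ω))] (x : Ω)
    (f : MulAction.orbitRel.Quotient G (Ω × Ω) → ℝ) :
    ∑ y, f (orbital G x y) = ∑ o, valency o x * f o := by
  classical
  rw [← Finset.sum_fiberwise Finset.univ (fun y => orbital G x y)]
  refine Finset.sum_congr rfl fun o _ => ?_
  rw [valency_eq_card_filter, ← nsmul_eq_mul, ← Finset.sum_const]
  refine Finset.sum_congr rfl fun y hy => ?_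
  rw [(Finset.mem_filter.mp hy).2]

open Classical in
/-- The adjacency matrix of an orbital. -/
noncomputable def orbitalMatrix : Matrix Ω Ω ℤ :=
  Matrix.of fun x y => if orbital G x y = o then 1 else 0

/-- The adjacency operator of an orbital on complex functions. -/
noncomputable def orbitalOperator [DecidableEq Ω] : Module.End ℂ (Ω → ℂ) :=
  Matrix.toLin' ((orbitalMatrix o).map (Int.castRingHom ℂ))

variable [DecidableEq Ω]

open Classical in
lemma orbitalOperator_apply (f : Ω → ℂ) (x : Ω) :
    orbitalOperator o f x = ∑ y, if orbital G x y = o then f y else 0 := by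
  simp only [orbitalOperator, Matrix.toLin'_apply, Matrix.mulVec, dotProduct, orbitalMatrix,
    Matrix.map_apply, Matrix.of_apply]
  exact Finset.sum_congr rfl fun y _ => by split_ifs <;> simp

lemma commute_orbitalOperator (g : G) : Commute (orbitalOperator o) (permRep G Ω g) :=
  commute_toLin'_permRep _ (fun g x y => by
    simp only [orbitalMatrix, Matrix.map_apply, Matrix.of_apply]
    rw [orbital_smul_smul]) g

lemma charpoly_orbitalOperator : (orbitalOperator o).charpoly =
    (orbitalMatrix o).charpoly.map (Int.castRingHom ℂ) := by
  rw [orbitalOperator, Matrix.charpoly_toLin', Matrix.charpoly_map]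

lemma trace_orbitalOperator [MulAction.IsPretransitive G Ω] {z : Ω} (h : o ≠ orbital G z z) :
    LinearMap.trace ℂ _ (orbitalOperator o) = 0 := by
  rw [orbitalOperator, Matrix.trace_toLin'_eq, Matrix.trace]
  refine Finset.sum_eq_zero fun x _ => ?_
  have : orbital G x x ≠ o := fun h' => h (h'.symm.trans (orbital_eq_diagonal_iff.mpr rfl))
  simp [orbitalMatrix, this]

lemma orbitalOperator_diagonal [MulAction.IsPretransitive G Ω] (z : Ω) (f : Ω → ℂ) :
    orbitalOperator (orbital G z z) f = f := by
  ext x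
  rw [orbitalOperator_apply]
  simp [orbital_eq_diagonal_iff]

lemma orbitalOperator_const [MulAction.IsPretransitive G Ω] (z : Ω) (a : ℂ) :
    orbitalOperator o (fun _ => a) = (valency o z : ℂ) • (fun _ => a) := by
  ext x
  rw [orbitalOperator_apply, valency_eq o z x, valency_eq_card_filter, ← Finset.sum_filter]
  simp

variable [Fintype (MulAction.orbitRel.Quotient G (Ω × Ω))]

lemma sum_orbitalOperator (f : Ω → ℂ) (x : Ω) :
    ∑ o : MulAction.orbitRel.Quotient G (Ω × Ω), orbitalOperator o f x = ∑ y, f y := by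
  classical
  simp only [orbitalOperator_apply]
  rw [Finset.sum_comm]
  simp

lemma mulVec_orbital (c : MulAction.orbitRel.Quotient G (Ω × Ω) → ℂ) (f : Ω → ℂ) :
    (Matrix.of fun x y => c (orbital G x y)).mulVec f = ∑ o, c o • orbitalOperator o f := by
  classical
  ext x
  simp only [Matrix.mulVec, dotProduct, Matrix.of_apply, Finset.sum_apply, Pi.smul_apply,
    orbitalOperator_apply, smul_eq_mul, Finset.mul_sum, mul_ite, mul_zero]
  rw [Finset.sum_comm]
  simp

end Matrices

/-- The inner products of the constituents, and the rank, of a transitive group with permutation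
character `1 + χ₁ + 2χ₂`. -/
lemma charInner_constituents [Finite Ω] [Fintype G] [MulAction.IsPretransitive G Ω] [Nonempty Ω]
    {χ₁ χ₂ : G → ℂ} (h₁ : IsIrreducibleCharacter χ₁) (h₂ : IsIrreducibleCharacter χ₂)
    (hne : χ₁ 1 ≠ χ₂ 1) (hchar : (permRep G Ω).character = fun g => 1 + χ₁ g + 2 * χ₂ g) :
    charInner 1 χ₁ = 0 ∧ charInner 1 χ₂ = 0 ∧ charInner χ₁ χ₂ = 0 ∧
      charInner (permRep G Ω).character χ₁ = 1 ∧
      Nat.card (MulAction.orbitRel.Quotient G (Ω × Ω)) = 6 := by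
  have := Fintype.ofFinite Ω
  have hexp : ∀ ψ : G → ℂ, charInner (permRep G Ω).character ψ =
      charInner 1 ψ + charInner χ₁ ψ + 2 * charInner χ₂ ψ := by
    intro ψ
    rw [hchar, charInner_add_left, charInner_add_left, charInner_smul_left]
    rfl
  have h00 : charInner (1 : G → ℂ) 1 = 1 := isIrreducibleCharacter_one.charInner_self
  have h12 : charInner χ₁ χ₂ = 0 := by
    by_contra h
    exact hne (congrFun (h₁.eq_of_charInner_ne_zero h₂ h) 1)
  have h11 := h₁.charInner_self
  have h22 := h₂.charInner_self
  obtain ⟨a, ha⟩ := h₁.exists_charInner_eq isIrreducibleCharacter_one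
  obtain ⟨b, hb⟩ := h₂.exists_charInner_eq isIrreducibleCharacter_one
  change charInner χ₁ 1 = a at ha
  change charInner χ₂ 1 = b at hb
  have hone : Nat.card (MulAction.orbitRel.Quotient G Ω) = 1 := by
    rw [Nat.card_eq_one_iff_unique]
    exact ⟨(MulAction.pretransitive_iff_subsingleton_quotient G Ω).mp inferInstance,
      ⟨Quotient.mk'' (Classical.arbitrary Ω)⟩⟩
  have h := hexp 1
  rw [charInner_permRep_one, hone, h00, ha, hb] at h
  -- Transitivity: the trivial character occurs exactly once in π, leaving no room in χ₁ or χ₂.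
  have h' : 1 = 1 + a + 2 * b := by exact_mod_cast h
  obtain rfl : a = 0 := by omega
  obtain rfl : b = 0 := by omega
  have h01 : charInner 1 χ₁ = 0 := by rw [charInner_comm, ha, Nat.cast_zero]
  have h02 : charInner 1 χ₂ = 0 := by rw [charInner_comm, hb, Nat.cast_zero]
  have h21 : charInner χ₂ χ₁ = 0 := by rw [charInner_comm, h12]
  have hp1 : charInner (permRep G Ω).character χ₁ = 1 := by
    rw [hexp, h01, h11, h21]; ring
  have hp2 : charInner (permRep G Ω).character χ₂ = 2 := by
    rw [hexp, h02, h12, h22]; ring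
  have hp0 : charInner (permRep G Ω).character 1 = 1 := by
    rw [hexp, h00, ha, hb]; simp
  refine ⟨h01, h02, h12, hp1, ?_⟩
  have hself := charInner_permRep_self (G := G) (Ω := Ω)
  rw [hexp, charInner_comm 1, charInner_comm χ₁, charInner_comm χ₂, hp0, hp1, hp2] at hself
  have : ((1 + 1 + 2 * 2 : ℕ) : ℂ) = Nat.card (MulAction.orbitRel.Quotient G (Ω × Ω)) := by
    rw [← hself]; norm_num
  exact (Nat.cast_inj.mp this).symm

/-- The numerical data attached to the orbitals of a transitive group of degree `3p` whose
permutation character is `1 + χ₁ + 2χ₂` with degrees `p + 1` and `p - 1`. -/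
theorem exists_orbital_eigenvalues [Fintype Ω] [Finite G] [MulAction.IsPretransitive G Ω]
    [Fintype (MulAction.orbitRel.Quotient G (Ω × Ω))] {d : ℕ}
    (hd : 3 ≤ d) (hΩ : Fintype.card Ω = 3 * (d + 1)) {χ₁ χ₂ : G → ℂ}
    (h₁ : IsIrreducibleCharacter χ₁) (h₂ : IsIrreducibleCharacter χ₂)
    (hd₁ : χ₁ 1 = (d + 2 : ℕ)) (hd₂ : χ₂ 1 = d)
    (hchar : ∀ g, (permRep G Ω).character g = 1 + χ₁ g + 2 * χ₂ g) (z : Ω) :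
    ∃ l t : MulAction.orbitRel.Quotient G (Ω × Ω) → ℤ,
      (∀ o ≠ orbital G z z, (valency o z : ℤ) + (d + 2) * l o + d * t o = 0) ∧
      l (orbital G z z) = 1 ∧ ∑ o, l o = 0 ∧
      (d + 2 : ℝ) * ∑ o, (l o : ℝ) ^ 2 / valency o z ≤ 3 * (d + 1) := by
  classical
  have := Fintype.ofFinite G
  have : Nonempty Ω := ⟨z⟩
  have hpi : (permRep G Ω).character = fun g => 1 + χ₁ g + 2 * χ₂ g := funext hchar
  have hne : χ₁ 1 ≠ χ₂ 1 := by
    rw [hd₁, hd₂, Ne, Nat.cast_inj]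
    omega
  obtain ⟨h01, h02, h12, hp1, -⟩ := charInner_constituents h₁ h₂ hne hpi
  obtain ⟨k, ρ, hρ, rfl⟩ := id h₁
  have hk : finrank ℂ (Fin k → ℂ) = d + 2 := by
    rw [char_one] at hd₁
    exact_mod_cast hd₁
  have hfr : finrank ℂ (IntertwiningMap ρ (permRep G Ω)) = 1 := by
    rw [charInner_character] at hp1
    exact_mod_cast hp1
  have : Nontrivial (IntertwiningMap ρ (permRep G Ω)) :=
    nontrivial_of_finrank_pos (R := ℂ) (by omega)
  obtain ⟨f, hf⟩ := exists_ne (0 : IntertwiningMap ρ (permRep G Ω))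
  have hinj : Function.Injective f :=
    (IsIrreducible.injective_or_eq_zero f).resolve_right hf
  have hf₀ : constIntertwining G Ω ≠ 0 := fun h => by
    have := congrFun (DFunLike.congr_fun h (1 : ℂ)) z
    exact one_ne_zero this
  choose lc hlc using fun o => exists_eigenvalue_of_finrank_eq_one hfr hf (orbitalOperator o)
    (commute_orbitalOperator o)
  have hspec := fun o => exists_rootMultiplicity_charpoly_eq h₁ h₂ hd₁ hd₂ h01 h02 h12
    (permRep G Ω) hchar (Representation.trivial ℂ G ℂ) ρ (by ext g; simp [character]) rfl
    (constIntertwining G Ω) f hf₀ hf (orbitalOperator o) (commute_orbitalOperator o)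
    (valency o z) (lc o) (fun w => orbitalOperator_const o z w) (hlc o)
  have hint : ∀ o, ∃ l : ℤ, lc o = l := by
    intro o
    obtain ⟨c, s, -, hmul, -⟩ := hspec o
    refine exists_intCast_eq_of_rootMultiplicity (orbitalMatrix o).charpoly_monic hd
      (valency o z) (lc o) c fun μ => ?_
    rw [← charpoly_orbitalOperator, hmul]
    simp
  choose l hl using hint
  have ht : ∀ o, ∃ t : ℤ, o ≠ orbital G z z →
      (valency o z : ℤ) + (d + 2) * l o + d * t = 0 := by
    intro o
    by_cases ho : o = orbital G z z
    -- An arbitrary default: the trace relation is claimed only off the diagonal.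
    · exact ⟨0, fun h => absurd ho h⟩
    obtain ⟨c, s, hroot, -, htr⟩ := hspec o
    rw [trace_orbitalOperator o ho, hl] at htr
    -- This sum is an algebraic integer, and d times it is an integer by the trace relation, so it
    -- is itself an integer.
    have hti : IsIntegral ℤ (∑ μ ∈ s, c μ * μ) := by
      refine IsIntegral.sum _ fun μ hμ => ((isIntegral_algebraMap (R := ℤ) (x := (c μ : ℤ))).mul
        ⟨(orbitalMatrix o).charpoly, (orbitalMatrix o).charpoly_monic, ?_⟩ : IsIntegral ℤ _)
      have := hroot μ hμ
      rwa [charpoly_orbitalOperator, Polynomial.IsRoot, Polynomial.eval_map] at this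
    obtain ⟨t, ht⟩ := exists_intCast_eq_of_mul_eq_intCast hti (d := d) (by omega)
      (-(valency o z + (d + 2) * l o)) (by
        push_cast at htr ⊢
        linear_combination -htr)
    refine ⟨t, fun _ => ?_⟩
    rw [ht] at htr
    have : ((valency o z + (d + 2) * l o + d * t : ℤ) : ℂ) = 0 := by
      push_cast at htr ⊢
      rw [← htr]
    exact_mod_cast this
  choose t ht using ht
  obtain ⟨w, hw⟩ : ∃ w, f w ≠ 0 := by
    by_contra! h
    exact hf (DFunLike.ext _ _ h)
  have hl1 : l (orbital G z z) = 1 := by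
    have h := hlc (orbital G z z) w
    rw [orbitalOperator_diagonal, hl] at h
    have h2 : ((l (orbital G z z) : ℂ) - 1) • f w = 0 := by rw [sub_smul, one_smul, ← h, sub_self]
    have h3 := (smul_eq_zero.mp h2).resolve_right hw
    exact_mod_cast sub_eq_zero.mp h3
  have hl0 : ∑ o, l o = 0 := by
    -- The orbital operators add up to the all-ones operator, whose values are constant functions.
    -- With a nonzero eigenvalue each `f w` would be determined by its value at `z`, forcing
    -- dimension at most 1.
    by_contra hsum
    have hsum' : (∑ o, (l o : ℂ)) ≠ 0 := by exact_mod_cast hsum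
    have hconst : ∀ w x, (∑ o, (l o : ℂ)) * f w x = ∑ y, f w y := by
      intro w x
      rw [← sum_orbitalOperator (G := G) (f w) x, Finset.sum_mul]
      exact Finset.sum_congr rfl fun o _ => by rw [hlc, hl]; rfl
    have hev : Function.Injective ((LinearMap.proj z : (Ω → ℂ) →ₗ[ℂ] ℂ) ∘ₗ f.toLinearMap) := by
      intro v w hvw
      apply hinj
      ext x
      have hvw' : f v z = f w z := hvw
      have h : (∑ o, (l o : ℂ)) * f v x = (∑ o, (l o : ℂ)) * f w x := by
        rw [hconst, hconst, ← hconst v z, ← hconst w z, hvw']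
      exact mul_left_cancel₀ hsum' h
    have := LinearMap.finrank_le_finrank_of_injective hev
    rw [hk, finrank_self] at this
    omega
  refine ⟨l, t, ht, hl1, hl0, ?_⟩
  set s : ℝ := ∑ o, (l o : ℝ) ^ 2 / valency o z with hs
  have hvpos : ∀ o : MulAction.orbitRel.Quotient G (Ω × Ω), (0 : ℝ) < valency o z :=
    fun o => by exact_mod_cast valency_pos o z
  have hspos : 0 < s := by
    refine Finset.sum_pos' (fun o _ => div_nonneg (sq_nonneg _) (hvpos o).le)
      ⟨orbital G z z, Finset.mem_univ _, ?_⟩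
    rw [hl1]
    simp [hvpos]
  -- These weights make both the eigenvalue ∑ c·l and each squared row norm ∑ n·c² equal to `s`, so
  -- Bessel reads (d+2)s² ≤ 3(d+1)s.
  let c : MulAction.orbitRel.Quotient G (Ω × Ω) → ℝ := fun o => l o / valency o z
  have hbessel := finrank_mul_sq_le_sum_sq f.toLinearMap hinj
    (Matrix.of fun x y => (c (orbital G x y) : ℂ)) s (fun w => by
      rw [mulVec_orbital fun o => (c o : ℂ), hs]
      push_cast
      rw [Finset.sum_smul]
      refine Finset.sum_congr rfl fun o _ => ?_
      rw [IntertwiningMap.toLinearMap_apply, hlc, hl, smul_smul]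
      congr 1
      simp only [c]
      push_cast
      ring)
  have hrow : ∀ x, ∑ y, ‖(Matrix.of fun x y => (c (orbital G x y) : ℂ)) x y‖ ^ 2 = s := by
    intro x
    have h := sum_valency_mul x (fun o => c o ^ 2)
    simp only [Matrix.of_apply, Complex.norm_real, Real.norm_eq_abs, sq_abs]
    rw [h, hs]
    refine Finset.sum_congr rfl fun o _ => ?_
    have := (hvpos o).ne'
    rw [valency_eq o x z]
    simp only [c]
    field_simp
  simp only [hrow, hk, Complex.norm_real, Real.norm_eq_abs, sq_abs] at hbessel
  rw [Finset.sum_const, Finset.card_univ, hΩ, nsmul_eq_mul] at hbessel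
  push_cast at hbessel
  have : ((d + 2 : ℝ) * s) * s ≤ (3 * (d + 1)) * s := by linarith
  exact le_of_mul_le_mul_right this hspos

end Orbitals

/-! ### Subdegrees at most two in primitive groups. -/

section SmallSubdegrees

variable {G Ω : Type*} [Group G] [MulAction G Ω]

/-- A subgroup normalized by a point stabilizer and by another subgroup not contained in it is
trivial, in a faithful primitive group, once it fixes a point. -/
lemma eq_bot_of_stabilizer_le_normalizer [FaithfulSMul G Ω] [Nontrivial Ω]
    [MulAction.IsPreprimitive G Ω] {x : Ω} {N : Subgroup G} (hN : N ≤ MulAction.stabilizer G x)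
    (h : MulAction.stabilizer G x ≤ Subgroup.normalizer (N : Set G))
    {g : G} (hg : g ∈ Subgroup.normalizer (N : Set G)) (hgx : g • x ≠ x) : N = ⊥ := by
  have hco := MulAction.IsPreprimitive.isCoatom_stabilizer_of_isPreprimitive G x
  have htop : Subgroup.normalizer (N : Set G) = ⊤ := by
    refine hco.2 _ (lt_of_le_of_ne h fun heq => hgx ?_)
    rw [← heq] at hg
    exact hg
  have hnorm : N.Normal := Subgroup.normalizer_eq_top_iff.mp htop
  rw [eq_bot_iff]
  intro n hn
  rw [Subgroup.mem_bot]
  refine FaithfulSMul.eq_of_smul_eq_smul (α := Ω) fun y => ?_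
  obtain ⟨a, rfl⟩ := MulAction.exists_smul_eq G x y
  have h1 : a⁻¹ * n * a ∈ N := by simpa using hnorm.conj_mem n hn a⁻¹
  have h2 : (a⁻¹ * n * a) • x = x := hN h1
  rw [mul_smul, mul_smul, inv_smul_eq_iff] at h2
  rw [h2, one_smul]

omit [MulAction G Ω] in
lemma le_normalizer_of_relIndex_le_two {H K : Subgroup G} (hHK : H ≤ K) (h0 : H.relIndex K ≠ 0)
    (h2 : H.relIndex K ≤ 2) : K ≤ Subgroup.normalizer (H : Set G) := by
  rw [← Subgroup.normal_subgroupOf_iff_le_normalizer hHK]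
  obtain h | h : (H.subgroupOf K).index = 1 ∨ (H.subgroupOf K).index = 2 := by
    change H.relIndex K = 1 ∨ H.relIndex K = 2
    omega
  · rw [Subgroup.index_eq_one.mp h]
    infer_instance
  · exact Subgroup.normal_of_index_eq_two h

/-- In a faithful primitive group, a nontrivial suborbit of length at most two bounds the order of
the point stabilizer. -/
theorem card_stabilizer_eq_ncard_orbit [Finite G] [FaithfulSMul G Ω] [Nontrivial Ω]
    [MulAction.IsPreprimitive G Ω] {x y : Ω} (hxy : y ≠ x)
    (h : (MulAction.orbit (MulAction.stabilizer G x) y).ncard ≤ 2) :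
    Nat.card (MulAction.stabilizer G x) =
      (MulAction.orbit (MulAction.stabilizer G x) y).ncard := by
  set X := MulAction.stabilizer G x
  set Y := MulAction.stabilizer G y
  obtain ⟨a, ha⟩ := MulAction.exists_smul_eq G x y
  have hcard : Nat.card X = Nat.card Y :=
    Nat.card_congr (MulAction.stabilizerEquivStabilizer ha.symm).toEquiv
  have hst : MulAction.stabilizer X y = Y.subgroupOf X := by
    ext g
    rfl
  have hrel : Y.relIndex X = (MulAction.orbit X y).ncard := by
    rw [← MulAction.index_stabilizer, hst]
    rfl
  have hmul : (X ⊓ Y).relIndex X = Y.relIndex X := Subgroup.inf_relIndex_left X Y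
  have hmul' : (X ⊓ Y).relIndex Y = X.relIndex Y := Subgroup.inf_relIndex_right X Y
  have hcX := Subgroup.relIndex_mul_relIndex ⊥ (X ⊓ Y) X bot_le inf_le_left
  have hcY := Subgroup.relIndex_mul_relIndex ⊥ (X ⊓ Y) Y bot_le inf_le_right
  rw [Subgroup.relIndex_bot_left, Subgroup.relIndex_bot_left] at hcX hcY
  rw [hmul] at hcX
  rw [hmul', ← hcard, ← hcX] at hcY
  -- X and Y have the same order, so X ⊓ Y has the same index in both. That index is at most 2,
  -- which makes X ⊓ Y normal in both.
  have hsymm : X.relIndex Y = Y.relIndex X := Nat.eq_of_mul_eq_mul_left Nat.card_pos hcY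
  rw [← hrel] at h ⊢
  have hpos : Y.relIndex X ≠ 0 :=
    ne_zero_of_dvd_ne_zero Nat.card_pos.ne' (Subgroup.relIndex_dvd_card Y X)
  suffices hbot : X ⊓ Y = ⊥ by
    rw [hbot, Subgroup.card_bot, one_mul] at hcX
    exact hcX.symm
  have hnormX : X ≤ Subgroup.normalizer ((X ⊓ Y : Subgroup G) : Set G) := by
    exact le_normalizer_of_relIndex_le_two inf_le_left (by rwa [hmul]) (by rwa [hmul])
  have hnormY : Y ≤ Subgroup.normalizer ((X ⊓ Y : Subgroup G) : Set G) := by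
    exact le_normalizer_of_relIndex_le_two inf_le_right (by rwa [hmul', hsymm])
      (by rwa [hmul', hsymm])
  -- An element normalizing X ⊓ Y and moving `x` is needed: if Y = X, the element `a` carrying `x`
  -- to `y`; otherwise any element of Y outside X.
  by_cases hYX : Y ≤ X
  · have hYX' : Y = X := Subgroup.eq_of_le_of_card_ge hYX hcard.le
    refine eq_bot_of_stabilizer_le_normalizer inf_le_left hnormX (g := a) ?_ (by rwa [ha])
    rw [hYX', inf_idem, Subgroup.mem_normalizer_iff]
    intro g
    have hconj := MulAction.stabilizer_smul_eq_stabilizer_map_conj a x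
    rw [ha] at hconj
    change Y = X.map _ at hconj
    conv_rhs => rw [← hYX', hconj]
    simp [Subgroup.mem_map]
  · obtain ⟨g, hgY, hgX⟩ := SetLike.not_le_iff_exists.mp hYX
    exact eq_bot_of_stabilizer_le_normalizer inf_le_left hnormX (hnormY hgY) hgX

end SmallSubdegrees

/-! ### Arithmetic of the subdegrees. -/

section Arithmetic

/-- The arithmetic of the subdegrees: five nontrivial subdegrees with eigenvalue data as below
include a subdegree equal to two. -/
lemma exists_subdegree_eq_two {ι : Type*} (s : Finset ι) (hs : s.card = 5) {d : ℕ} (hd : 3 ≤ d)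
    (n l t : ι → ℤ) (hn : ∀ i ∈ s, 0 < n i) (h : ∀ i ∈ s, n i + (d + 2) * l i + d * t i = 0)
    (hsn : ∑ i ∈ s, n i = 3 * d + 2) (hsl : ∑ i ∈ s, l i = -1)
    (hsq : (d + 2 : ℝ) * (1 + ∑ i ∈ s, (l i : ℝ) ^ 2 / n i) ≤ 3 * (d + 1)) :
    ∃ i ∈ s, n i = 2 := by
  have hnR : ∀ i ∈ s, (0 : ℝ) < n i := fun i hi => by exact_mod_cast hn i hi
  have hterm : ∀ i ∈ s, 0 ≤ (l i : ℝ) ^ 2 / n i := fun i hi =>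
    div_nonneg (sq_nonneg _) (hnR i hi).le
  -- 3(d+1)/(d+2) < 3, and the diagonal orbital accounts for 1.
  have hlt : ∑ i ∈ s, (l i : ℝ) ^ 2 / n i < 2 := by
    by_contra! hge
    have : (0 : ℝ) < d + 2 := by positivity
    nlinarith
  have ha : ∀ i ∈ s, n i = d * (-(l i + t i)) - 2 * l i := fun i hi => by
    linear_combination h i hi
  have hdZ : (3 : ℤ) ≤ d := by exact_mod_cast hd
  have ha0 : ∀ i ∈ s, 0 ≤ -(l i + t i) := by
    intro i hi
    by_contra! hneg
    -- If a ≤ -1, then n ≤ -3 - 2l, so 2n ≤ -6 - 4l ≤ l² - 2; this single term would already reach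
    -- 2.
    have h2 : 2 * n i ≤ l i ^ 2 := by
      have := ha i hi
      nlinarith [sq_nonneg (l i + 2)]
    have h3 : (2 : ℝ) ≤ (l i : ℝ) ^ 2 / n i := by
      rw [le_div_iff₀ (hnR i hi)]
      exact_mod_cast h2
    have h4 := Finset.single_le_sum hterm hi
    linarith
  have hsum : ∑ i ∈ s, -(l i + t i) = 3 := by
    have h5 : ∑ i ∈ s, n i = d * ∑ i ∈ s, -(l i + t i) - 2 * ∑ i ∈ s, l i := by
      rw [Finset.mul_sum, Finset.mul_sum, ← Finset.sum_sub_distrib]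
      exact Finset.sum_congr rfl ha
    rw [hsn, hsl] at h5
    have : (d : ℤ) * (∑ i ∈ s, -(l i + t i) - 3) = 0 := by linarith
    rcases mul_eq_zero.mp this with h6 | h6 <;> omega
  set z := s.filter fun i => -(l i + t i) = 0 with hz
  -- Among five nonnegative integers with sum 3, at most three are nonzero.
  have hzcard : 2 ≤ z.card := by
    have h6 : (s.filter fun i => ¬ -(l i + t i) = 0).card ≤ 3 := by
      have h7 : ((s.filter fun i => ¬ -(l i + t i) = 0).card : ℤ) ≤ ∑ i ∈ s, -(l i + t i) := by
        rw [Finset.cast_card, Finset.sum_filter]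
        refine Finset.sum_le_sum fun i hi => ?_
        have := ha0 i hi
        split_ifs <;> omega
      omega
    have h8 : z.card + (s.filter fun i => ¬ -(l i + t i) = 0).card = s.card :=
      Finset.card_filter_add_card_filter_not _
    omega
  have hzn : ∀ i ∈ z, n i = -2 * l i := by
    intro i hi
    obtain ⟨his, hi0⟩ := Finset.mem_filter.mp hi
    rw [ha i his, hi0]
    ring
  by_contra! hno
  have hbig : ∀ i ∈ z, (1 : ℝ) ≤ (l i : ℝ) ^ 2 / n i := by
    intro i hi
    have his := (Finset.mem_filter.mp hi).1
    have h1 := hzn i hi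
    have h2 := hn i his
    have h3 := hno i his
    rw [one_le_div₀ (hnR i his)]
    -- n = -2l is positive and not 2, hence l ≤ -2.
    have : n i ≤ l i ^ 2 := by nlinarith [show l i ≤ -2 by omega]
    exact_mod_cast this
  have h9 : (z.card : ℝ) ≤ ∑ i ∈ z, (l i : ℝ) ^ 2 / n i := by
    rw [Finset.cast_card]
    exact Finset.sum_le_sum hbig
  have h10 := Finset.sum_le_sum_of_subset_of_nonneg (Finset.filter_subset _ s)
    (fun i hi _ => hterm i hi) (s := z)
  have h11 : (2 : ℝ) ≤ z.card := by exact_mod_cast hzcard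
  linarith

end Arithmetic

/-! ### Degree bounds from a small subdegree. -/

section Rank

variable {G Ω : Type*} [Group G] [MulAction G Ω]

lemma ncard_orbit_le_card [Finite G] (y : Ω) :
    (MulAction.orbit G y).ncard ≤ Nat.card G :=
  Finite.card_range_le _

lemma sum_valency_eq_card [Fintype Ω] [Fintype (MulAction.orbitRel.Quotient G (Ω × Ω))] (z : Ω) :
    ∑ o : MulAction.orbitRel.Quotient G (Ω × Ω), valency o z = Fintype.card Ω := by
  have h := sum_valency_mul (G := G) z (fun _ => 1)
  simp only [Finset.sum_const, Finset.card_univ, nsmul_eq_mul, mul_one] at h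
  exact_mod_cast h.symm

variable [Finite G] [FaithfulSMul G Ω] [Nontrivial Ω] [MulAction.IsPreprimitive G Ω]

lemma valency_eq_card_stabilizer {o : MulAction.orbitRel.Quotient G (Ω × Ω)} {z : Ω}
    (ho : o ≠ orbital G z z) (h2 : valency o z ≤ 2) :
    valency o z = Nat.card (MulAction.stabilizer G z) := by
  obtain ⟨y, rfl⟩ := exists_orbital_eq o z
  have hy : y ≠ z := fun h => ho (by rw [h])
  rw [valency_orbital] at h2 ⊢
  exact (card_stabilizer_eq_ncard_orbit hy h2).symm

/-- In a faithful primitive group of rank six with a nontrivial subdegree `k ≤ 2`, the degree is at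
most `1 + 5k`. -/
lemma card_le_of_valency_le_two [Fintype Ω]
    (hrank : Nat.card (MulAction.orbitRel.Quotient G (Ω × Ω)) = 6)
    {o : MulAction.orbitRel.Quotient G (Ω × Ω)} {z : Ω}
    (ho : o ≠ orbital G z z) (h2 : valency o z ≤ 2) :
    Fintype.card Ω ≤ 1 + 5 * valency o z := by
  classical
  have : Fintype (MulAction.orbitRel.Quotient G (Ω × Ω)) := Fintype.ofFinite _
  rw [Nat.card_eq_fintype_card] at hrank
  rw [← sum_valency_eq_card (G := G) z, ← Finset.add_sum_erase _ _ (Finset.mem_univ (orbital G z z)),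
    valency_diagonal, valency_eq_card_stabilizer ho h2]
  refine Nat.add_le_add_left ((Finset.sum_le_card_nsmul _ _ (Nat.card (MulAction.stabilizer G z))
    fun o' _ => ?_).trans_eq ?_) 1
  · obtain ⟨y, rfl⟩ := exists_orbital_eq o' z
    rw [valency_orbital]
    exact ncard_orbit_le_card y
  · rw [Finset.card_erase_of_mem (Finset.mem_univ _), Finset.card_univ, hrank, smul_eq_mul]

omit [FaithfulSMul G Ω] in
/-- A regular primitive group has prime degree. -/
lemma prime_card_of_card_stabilizer_eq_one [Fintype Ω] (z : Ω)
    (h : Nat.card (MulAction.stabilizer G z) = 1) : (Fintype.card Ω).Prime := by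
  have hco := MulAction.IsPreprimitive.isCoatom_stabilizer_of_isPreprimitive G z
  have hbot : MulAction.stabilizer G z = ⊥ := Subgroup.card_eq_one.mp h
  have hcard : Nat.card G = Fintype.card Ω := by
    rw [← Subgroup.index_bot, ← hbot, MulAction.index_stabilizer_of_transitive,
      Nat.card_eq_fintype_card]
  have hgt : 1 < Fintype.card Ω := Fintype.one_lt_card
  obtain ⟨q, hq, hqd⟩ := Nat.exists_prime_and_dvd hgt.ne'
  have := Fact.mk hq
  obtain ⟨g, hg⟩ := exists_prime_orderOf_dvd_card' (G := G) q (by rwa [hcard])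
  -- The trivial stabilizer is a maximal subgroup, so an element of prime order generates G.
  have htop : Subgroup.zpowers g = ⊤ := by
    refine hco.2 _ ?_
    rw [hbot, bot_lt_iff_ne_bot, Ne, Subgroup.zpowers_eq_bot]
    rintro rfl
    rw [orderOf_one] at hg
    exact hq.one_lt.ne hg
  rw [← hcard, ← Subgroup.card_top, ← htop, Nat.card_zpowers, hg]
  exact hq

end Rank

/-! ### Conclusion: small primes and the general case. -/

theorem theorem10p3 {p : ℕ} (hp : p.Prime) {Ω : Type*} [Fintype Ω]
    (hΩ : Fintype.card Ω = 3 * p) (G : Subgroup (Equiv.Perm Ω))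
    (hG : MulAction.IsPreprimitive G Ω) :
    ¬ ∃ χ₁ χ₂ : G → ℂ,
      IsIrreducibleCharacter χ₁ ∧ IsIrreducibleCharacter χ₂ ∧
      χ₁ 1 = (p : ℂ) + 1 ∧ χ₂ 1 = (p : ℂ) - 1 ∧
      ∀ g : G, permutationCharacter G g = 1 + χ₁ g + 2 * χ₂ g := by
  classical
  rintro ⟨χ₁, χ₂, h₁, h₂, hd₁, hd₂, hchar⟩
  have hp2 := hp.two_le
  have : Fintype G := Fintype.ofFinite G
  have : Nontrivial Ω := Fintype.one_lt_card_iff_nontrivial.mp (by omega)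
  let z : Ω := Classical.arbitrary Ω
  have hchar' : (permRep G Ω).character = fun g => 1 + χ₁ g + 2 * χ₂ g := by
    rw [← character_ofMulAction_eq_permRep]
    exact funext hchar
  have hne : χ₁ 1 ≠ χ₂ 1 := by
    rw [hd₁, hd₂]
    intro h
    have : (2 : ℂ) = 0 := by linear_combination h
    norm_num at this
  obtain ⟨-, -, -, -, hrank⟩ := charInner_constituents h₁ h₂ hne hchar'
  have : Fintype (MulAction.orbitRel.Quotient G (Ω × Ω)) := Fintype.ofFinite _
  have hcard6 := hrank
  rw [Nat.card_eq_fintype_card] at hcard6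
  let s : Finset (MulAction.orbitRel.Quotient G (Ω × Ω)) := Finset.univ.erase (orbital G z z)
  have hs : s.card = 5 := by
    rw [Finset.card_erase_of_mem (Finset.mem_univ _), Finset.card_univ, hcard6]
  have hsum := sum_valency_eq_card (G := G) z
  rw [← Finset.add_sum_erase _ _ (Finset.mem_univ (orbital G z z)), valency_diagonal, hΩ] at hsum
  change 1 + ∑ o ∈ s, valency o z = 3 * p at hsum
  by_cases hp3 : p ≤ 3
  -- Five subdegrees, all at least 2, would sum to at least 10, but the sum is 3p - 1 ≤ 8.
  · obtain ⟨o, hos, ho⟩ : ∃ o ∈ s, valency o z < 2 := by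
      by_contra! h
      have := Finset.card_nsmul_le_sum s _ 2 h
      rw [hs, smul_eq_mul] at this
      omega
    have hoz : o ≠ orbital G z z := Finset.ne_of_mem_erase hos
    have hpos := valency_pos o z
    have ho1 : valency o z = 1 := by omega
    have hprime := prime_card_of_card_stabilizer_eq_one (G := G) z
      (by rw [← valency_eq_card_stabilizer hoz (by omega), ho1])
    rw [hΩ] at hprime
    exact Nat.not_prime_mul (by norm_num) hp.one_lt.ne' hprime
  · obtain ⟨d, rfl⟩ : ∃ d, p = d + 1 := ⟨p - 1, by omega⟩
    obtain ⟨l, t, ht, hl1, hl0, hsq⟩ := exists_orbital_eigenvalues (d := d) (by omega) hΩ h₁ h₂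
      (by rw [hd₁]; push_cast; ring) (by rw [hd₂]; push_cast; ring) (congrFun hchar') z
    rw [← Finset.add_sum_erase _ _ (Finset.mem_univ (orbital G z z)), hl1] at hl0 hsq
    obtain ⟨o, hos, ho⟩ := exists_subdegree_eq_two s hs (d := d) (by omega)
      (fun o => (valency o z : ℤ)) l t (fun o _ => by exact_mod_cast valency_pos o z)
      (fun o hos => ht o (Finset.ne_of_mem_erase hos)) (by
        have : ((1 + ∑ o ∈ s, valency o z : ℕ) : ℤ) = ((3 * (d + 1) : ℕ) : ℤ) := by rw [hsum]
        push_cast at this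
        linarith) (by linarith) (by
        rw [valency_diagonal, Int.cast_one, Nat.cast_one, one_pow, div_one] at hsq
        simpa only [Int.cast_natCast] using hsq)
    have ho2 : valency o z = 2 := by exact_mod_cast ho
    -- This gives |Ω| ≤ 11, whereas p > 3 gives |Ω| = 3p ≥ 12.
    have := card_le_of_valency_le_two hrank (Finset.ne_of_mem_erase hos) ho2.le
    omega
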